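/- For a semigroup $S$, let $S^1=S$ if $S$ has an identity element, and let $S^1=S\cup\{1\}$ with an identity element $1$ adjoined otherwise. For a set $X$ let $X^*$ be the set of finite words over $X$. For $s\in S$ define $\varphi_s:(S^1)^*\to S^*\subseteq (S^1)^*$ by $$\varphi_s([a_1,a_2,\ldots,a_k])=[sa_1,\;sa_1a_2,\;\ldots,\;sa_1a_2\cdots a_k],\qquad \varphi_s(\epsilon)=\epsilon,$$ and let $Cayley(S)$ be the semigroup generated by $\{\varphi_s : s\in S\}$ under composition of functions. Call a semigroup $T$ aperiodic if there is an integer $n\ge 1$ such that $x^n=x^{n+1}$ for all $x\in T$. Proposition. Let $S$ be a finite semigroup. The following are equivalent. 1. $S$ has no nontrivial subgroups (a subgroup of $S$ is a subsemigroup which is a group under the multiplication of $S$; its identity need not be an identity of $S$). 2. $S$ is aperiodic. 3. $Cayley(S)$ is finite. 4. $Cayley(S)$ is aperiodic. 5. For every $f\in Cayley(S)$ there is an integer $n\ge 1$, possibly depending on $f$, such that $f^n=f^{n+1}$. -/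

import Mathlib

namespace CayleySemigroup

universe u

/-- `G` is a subgroup of the semigroup `S`: a subsemigroup that is a group under the multiplication
of `S`. Its identity element need not be an identity element of `S`. -/
def IsSubgroup {S : Type u} [Semigroup S] (G : Subsemigroup S) : Prop :=
  ∃ e ∈ G, (∀ g ∈ G, e * g = g ∧ g * e = g) ∧ ∀ g ∈ G, ∃ h ∈ G, g * h = e ∧ h * g = e

/-- The semigroup `S` has no nontrivial subgroups: every subgroup of `S` has just one element. -/
def NoNontrivialSubgroups (S : Type u) [Semigroup S] : Prop :=
  ∀ G : Subsemigroup S, IsSubgroup G → (G : Set S).Subsingleton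

/-- The semigroup `T` satisfies `x ^ n = x ^ (n + 1)` for some positive `n` that does not depend on
`x`. The powers are those of `T`, computed in the monoid `WithOne T` that contains `T`. -/
def IsAperiodic (T : Type u) [Semigroup T] : Prop :=
  ∃ n : ℕ, 0 < n ∧ ∀ x : T, (x : WithOne T) ^ n = (x : WithOne T) ^ (n + 1)

/-- Every element `x` of the semigroup `T` satisfies `x ^ n = x ^ (n + 1)` for some positive `n`,
which may depend on `x`. -/
def IsPointwiseAperiodic (T : Type u) [Semigroup T] : Prop :=
  ∀ x : T, ∃ n : ℕ, 0 < n ∧ (x : WithOne T) ^ n = (x : WithOne T) ^ (n + 1)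

/-- The semigroup `S` is a monoid, that is, it has a two-sided identity element. -/
def HasIdentity (S : Type u) [Semigroup S] : Prop :=
  ∃ e : S, ∀ x : S, e * x = x ∧ x * e = x

/-- The underlying set of `S¹`: all the elements of `S`, together with the new identity element `1`
exactly when `S` has no identity element of its own. -/
abbrev S1 (S : Type u) [Semigroup S] : Type u :=
  {x : WithOne S // x = 1 → ¬ HasIdentity S}

/-- The inclusion of `S` into `S¹`. -/
def incl {S : Type u} [Semigroup S] (s : S) : S1 S :=
  ⟨(s : WithOne S), fun h => absurd h WithOne.coe_ne_one⟩

/-- The product `s * x`, which lies in `S`, of `s` in `S` and `x` in `S` with `1` adjoined. -/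
def mulWithOne {S : Type u} [Semigroup S] (s : S) : WithOne S → S
  | none => s
  | some t => s * t

theorem coe_mulWithOne {S : Type u} [Semigroup S] (s : S) (x : WithOne S) :
    ((mulWithOne s x : S) : WithOne S) = (s : WithOne S) * x := by
  cases x <;> rfl

/-- The function `φ_s : (S¹)* → S*`,
`φ_s [a₁, a₂, …, aₖ] = [s a₁, s a₁ a₂, …, s a₁ a₂ ⋯ aₖ]`. -/
def phi {S : Type u} [Semigroup S] : S → List (S1 S) → List S
  | _, [] => []
  | s, a :: w => mulWithOne s a.1 :: phi (mulWithOne s a.1) w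

theorem length_phi {S : Type u} [Semigroup S] (s : S) (w : List (S1 S)) :
    (phi s w).length = w.length := by
  induction w generalizing s with
  | nil => rfl
  | cons a w ih => simp [phi, ih]

/-- The `i`-th letter (counted from zero) of `φ_s [a₁, …, aₖ]` is `s a₁ ⋯ aᵢ₊₁`. -/
theorem getElem_phi {S : Type u} [Semigroup S] (s : S) (w : List (S1 S)) (i : ℕ)
    (hi : i < (phi s w).length) :
    (((phi s w)[i] : S) : WithOne S) =
      (s : WithOne S) * ((w.take (i + 1)).map Subtype.val).prod := by
  induction w generalizing s i with
  | nil => simp [phi] at hi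
  | cons a w ih =>
    cases i with
    | zero => simp [phi, coe_mulWithOne]
    | succ i =>
      have h := ih (mulWithOne s a.1) i (by simpa [phi] using hi)
      simp only [phi, List.getElem_cons_succ, h, coe_mulWithOne, List.take_succ_cons,
        List.map_cons, List.prod_cons, mul_assoc]

/-- The function `φ_s`, as a map from `(S¹)*` to itself (its values are words over `S ⊆ S¹`). -/
def gen {S : Type u} [Semigroup S] (s : S) : Function.End (List (S1 S)) :=
  fun w => (phi s w).map incl

/-- The Cayley semigroup `Cayley(S)`: the semigroup generated, under composition of functions, by
the functions `φ_s` with `s` in `S`. -/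
def Cayley (S : Type u) [Semigroup S] : Subsemigroup (Function.End (List (S1 S))) :=
  Subsemigroup.closure (Set.range gen)

end CayleySemigroup

/-! Let `S` be aperiodic. A composite of maps `φ_s` is a column of letters, and reading one letter
makes the column descending: each letter is a left multiple of the preceding one. Finiteness of
`Cayley S` is by induction on an ideal containing the column. Reading a letter right-multiplies an
initial part of a descending column and sends the rest into a smaller ideal
(`exists_nextCol_eq_append`), so a bounded number of states suffices (`finite_colAct_isDescending`).
On each word the iterates stabilise (`exists_iterate_colAct_eq`); finiteness makes this uniform.

Conversely, let g lie in a subgroup with identity e. On words in powers of g, φ_e takes partial sums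
of exponents, that is, divides generating series by 1 - X. An eventual period of φ_e then forces g =
e (`gen_zpow_eq_of_pow_eq`). -/

namespace CayleySemigroup

/-! ### Columns of letters and ideals of a monoid. -/

section Monoid

variable {M : Type*} [Monoid M]

/-- The words `[s a₁, s a₁ a₂, …]` of the partial products of `[s, a₁, a₂, …]`, in a monoid. -/
def partialProds : M → List M → List M
  | _, [] => []
  | s, a :: w => (s * a) :: partialProds (s * a) w

/-- The composition of the functions `partialProds s` for the successive letters `s` of a column;
the first letter acts first. -/
def colAct : List M → List M → List M
  | [], w => w
  | s :: u, w => colAct u (partialProds s w)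

/-- The column reached from a given column after a letter has been read. -/
def nextCol : List M → M → List M
  | [], _ => []
  | s :: u, a => (s * a) :: nextCol u (s * a)

/-- The letter that a column produces from a given letter. -/
def colOut : List M → M → M
  | [], a => a
  | s :: u, a => colOut u (s * a)

theorem colAct_nil_right (u : List M) : colAct u [] = [] := by
  induction u with
  | nil => rfl
  | cons s u ih => simpa [colAct, partialProds] using ih

theorem colAct_cons_right (u : List M) (a : M) (w : List M) :
    colAct u (a :: w) = colOut u a :: colAct (nextCol u a) w := by
  induction u generalizing a w with
  | nil => rfl
  | cons s u ih => simp [colAct, partialProds, nextCol, colOut, ih]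

theorem colAct_append (u v w : List M) : colAct (u ++ v) w = colAct v (colAct u w) := by
  induction u generalizing w with
  | nil => rfl
  | cons s u ih => simp [colAct, ih]

theorem nextCol_take (u : List M) (a : M) (q : ℕ) :
    nextCol (u.take q) a = (nextCol u a).take q := by
  induction u generalizing a q with
  | nil => simp [nextCol]
  | cons s u ih => cases q <;> simp [nextCol, ih]

/-- Two-sided ideals of a monoid, as sets. -/
def IsIdealSet (I : Set M) : Prop :=
  ∀ x ∈ I, ∀ s t : M, s * x * t ∈ I

theorem IsIdealSet.mul_left {I : Set M} (hI : IsIdealSet I) {x : M} (hx : x ∈ I) (s : M) :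
    s * x ∈ I := by
  simpa using hI x hx s 1

theorem IsIdealSet.mul_right {I : Set M} (hI : IsIdealSet I) {x : M} (hx : x ∈ I) (t : M) :
    x * t ∈ I := by
  simpa using hI x hx 1 t

theorem IsIdealSet.nextCol_subset {I : Set M} (hI : IsIdealSet I) (u : List M)
    (hu : ∀ x ∈ u, x ∈ I) (a : M) : ∀ x ∈ nextCol u a, x ∈ I := by
  induction u generalizing a with
  | nil => simp [nextCol]
  | cons s u ih =>
    simp only [nextCol, List.mem_cons, forall_eq_or_imp] at hu ⊢
    exact ⟨hI.mul_right hu.1 a, ih hu.2 _⟩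

theorem IsIdealSet.nextCol_subset_of_mem {I : Set M} (hI : IsIdealSet I) (u : List M) {a : M}
    (ha : a ∈ I) : ∀ x ∈ nextCol u a, x ∈ I := by
  induction u generalizing a with
  | nil => simp [nextCol]
  | cons s u ih =>
    simp only [nextCol, List.mem_cons, forall_eq_or_imp]
    exact ⟨hI.mul_left ha s, ih (hI.mul_left ha s)⟩

/-- A column each of whose letters is a left multiple of the preceding one. -/
def IsDescending (u : List M) : Prop :=
  u.IsChain fun x y => ∃ s, y = s * x

theorem isDescending_nextCol (u : List M) (a : M) : IsDescending (nextCol u a) := by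
  induction u generalizing a with
  | nil => exact List.IsChain.nil
  | cons s u ih =>
    cases u with
    | nil => exact List.IsChain.singleton _
    | cons t u => exact List.IsChain.cons_cons ⟨t, rfl⟩ (ih (s * a))

theorem IsDescending.map_mul_right {u : List M} (hu : IsDescending u) (c : M) :
    IsDescending (u.map (· * c)) := by
  refine (List.isChain_map _).2 (List.IsChain.imp ?_ hu)
  rintro x _ ⟨s, rfl⟩
  exact ⟨s, by rw [mul_assoc]⟩

/-- Iterating y = s y t gives y = s^k y t^k, so aperiodicity yields s y = y. This is applied twice:
to erase `s`, then with `x` in the role of `s`. -/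
theorem isIdempotentElem_of_eq_mul_sq_mul {n : ℕ} (hM : ∀ x : M, x ^ n = x ^ (n + 1)) {x s t : M}
    (h : x = s * (x * x) * t) : x * x = x := by
  have key : ∀ {s y t : M}, y = s * y * t → s * y = y := by
    intro s y t h
    have hk : ∀ k : ℕ, y = s ^ k * y * t ^ k := by
      intro k
      induction k with
      | zero => simp
      | succ k ih =>
        calc y = s ^ k * (s * y * t) * t ^ k := by rw [← h]; exact ih
          _ = s ^ (k + 1) * y * t ^ (k + 1) := by
            rw [pow_succ s, pow_succ' t]; simp only [mul_assoc]
    calc s * y = s ^ (n + 1) * y * t ^ n := by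
          conv_lhs => rw [hk n]
          rw [pow_succ' s]; simp only [mul_assoc]
      _ = y := by rw [← hM, ← hk n]
  have h1 : s * x = x := key (t := x * t) (by simpa only [mul_assoc] using h)
  have h2 : x = x * x * t := by
    rw [← mul_assoc s x x, h1] at h
    exact h
  exact key h2

/-- An idempotent letter x has no effect on later ones: z = r x gives z (x a) = z a. After the first
non-idempotent x, everything falls into `I₀`, because x * x does. This cut does not depend on `a`.
-/
theorem exists_nextCol_eq_append {n : ℕ} (hM : ∀ x : M, x ^ n = x ^ (n + 1)) {I I₀ : Set M}
    (hI₀ : IsIdealSet I₀)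
    (hsq : ∀ x ∈ I, x * x ∉ I₀ → ∃ s t, x = s * (x * x) * t)
    {u : List M} (hu : ∀ x ∈ u, x ∈ I) (hd : IsDescending u) :
    ∃ p : ℕ, ∀ a : M, ∃ v : List M, (∀ x ∈ v, x ∈ I₀) ∧
      nextCol u a = (u.take p).map (· * a) ++ v := by
  induction u with
  | nil => exact ⟨0, fun a => ⟨[], by simp, rfl⟩⟩
  | cons x u ih =>
    cases u with
    | nil => exact ⟨1, fun a => ⟨[], by simp, rfl⟩⟩
    | cons z u =>
      obtain ⟨⟨r, hr⟩, hd'⟩ := List.isChain_cons_cons.1 hd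
      by_cases hx : x * x = x
      · obtain ⟨p, hp⟩ := ih (fun y hy => hu y (List.mem_cons_of_mem _ hy)) hd'
        refine ⟨p + 1, fun a => ?_⟩
        obtain ⟨v, hv, he⟩ := hp a
        refine ⟨v, hv, ?_⟩
        have hz : z * (x * a) = z * a := by rw [hr, ← mul_assoc, mul_assoc r, hx]
        have : nextCol (z :: u) (x * a) = nextCol (z :: u) a := by simp [nextCol, hz]
        rw [nextCol, this, he]
        rfl
      · refine ⟨1, fun a => ⟨nextCol (z :: u) (x * a), ?_, rfl⟩⟩
        have hxx : x * x ∈ I₀ := by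
          by_contra hxx
          obtain ⟨s, t, h⟩ := hsq x (hu x List.mem_cons_self) hxx
          exact hx (isIdempotentElem_of_eq_mul_sq_mul hM h)
        have hz : z * (x * a) ∈ I₀ := by
          have := hI₀ _ hxx r a
          rwa [show z * (x * a) = r * (x * x) * a by rw [hr]; simp only [mul_assoc]]
        simp only [nextCol, List.mem_cons, forall_eq_or_imp]
        exact ⟨hz, hI₀.nextCol_subset_of_mem u hz⟩

end Monoid

/-! ### Automata with finitely many states. -/

section Automata

variable {A : Type*} [Finite A]

/-- The function computed by an automaton with transition and output table `δ`. -/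
def runTable {Q : Type*} (δ : Q → A → A × Q) : Q → List A → List A
  | _, [] => []
  | q, a :: w => (δ q a).1 :: runTable δ (δ q a).2 w

/-- The functions computed by automata with a given finite set of states are finite in number. -/
theorem finite_of_forall_exists_automaton (Q : Type*) [Finite Q] (X : Set (List A → List A))
    (h : ∀ f ∈ X, ∃ st : Q → List A → List A, (∃ q, st q = f) ∧
      ∀ q, st q [] = [] ∧ ∀ a, ∃ b q', ∀ w, st q (a :: w) = b :: st q' w) : X.Finite := by
  refine (Set.finite_range fun p : (Q → A → A × Q) × Q => runTable p.1 p.2).subset ?_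
  intro f hf
  obtain ⟨st, ⟨q, rfl⟩, hst⟩ := h f hf
  choose hnil b q' hcons using hst
  have key : ∀ w q, runTable (fun q a => (b q a, q' q a)) q w = st q w := by
    intro w
    induction w with
    | nil => intro q; rw [hnil]; rfl
    | cons a w ih => intro q; rw [hcons, runTable, ih]
  exact ⟨(_, q), funext fun w => key w q⟩

end Automata

/-! ### Finiteness of the set of column functions, by induction on ideals. -/

section Finiteness

variable {M : Type*} [Monoid M] [Finite M]

theorem finite_colAct_isDescending {n : ℕ} (hM : ∀ x : M, x ^ n = x ^ (n + 1)) {I I₀ : Set M}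
    (hI : IsIdealSet I) (hI₀ : IsIdealSet I₀)
    (hsq : ∀ x ∈ I, x * x ∉ I₀ → ∃ s t, x = s * (x * x) * t)
    (hfin : {f : List M → List M | ∃ u : List M, (∀ x ∈ u, x ∈ I₀) ∧ f = colAct u}.Finite) :
    {f : List M → List M |
      ∃ u : List M, (∀ x ∈ u, x ∈ I) ∧ IsDescending u ∧ f = colAct u}.Finite := by
  set L := {f : List M → List M | ∃ u : List M, (∀ x ∈ u, x ∈ I₀) ∧ f = colAct u} with hL
  have : Finite L := hfin
  -- A state holds the function of the tail over `I₀`, the cut, and the product c of the letters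
  -- read. Cuts are the full length (`none`) or some `p c`, so the state set does not depend on `u`.
  refine finite_of_forall_exists_automaton (L × Option M × M) _ ?_
  rintro f ⟨u, hu, hd, rfl⟩
  have hcut : ∀ c : M, ∃ p : ℕ, ∀ a : M, ∃ v : List M, (∀ x ∈ v, x ∈ I₀) ∧
      nextCol (u.map (· * c)) a = ((u.map (· * c)).take p).map (· * a) ++ v := fun c =>
    exists_nextCol_eq_append hM hI₀ hsq
      (by
        simp only [List.mem_map]
        rintro _ ⟨x, hx, rfl⟩
        exact hI.mul_right (hu x hx) c)
      (hd.map_mul_right c)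
  choose p hp using hcut
  -- the positions at which the column can be cut
  let cut : Option M → ℕ := fun o => o.elim u.length p
  have hmin : ∀ o c, ∃ o', cut o' = min (cut o) (p c) := by
    intro o c
    rcases le_total (cut o) (p c) with h | h
    · exact ⟨o, (min_eq_left h).symm⟩
    · exact ⟨some c, (min_eq_right h).symm⟩
  refine ⟨fun q w => q.1.1 (colAct ((u.take (cut q.2.1)).map (· * q.2.2)) w),
    ⟨(⟨id, [], by simp, rfl⟩, none, 1), ?_⟩, ?_⟩
  · funext w
    simp [cut]
  · rintro ⟨⟨_, v, hv, rfl⟩, o, c⟩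
    refine ⟨by simp [colAct_nil_right], fun a => ?_⟩
    obtain ⟨r, hr, he⟩ := hp c a
    obtain ⟨o', ho'⟩ := hmin o c
    have hnext : ∃ r' : List M, (∀ x ∈ r', x ∈ I₀) ∧
        nextCol ((u.take (cut o)).map (· * c)) a
          = (u.take (cut o')).map (· * (c * a)) ++ r' := by
      refine ⟨r.take (cut o - ((u.take (p c)).map (· * (c * a))).length),
        fun x hx => hr x (List.mem_of_mem_take hx), ?_⟩
      rw [List.map_take, nextCol_take, he, ← List.map_take, List.map_map]
      have : ((fun x => x * a) ∘ fun x => x * c) = fun x => x * (c * a) := by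
        funext x; simp [mul_assoc]
      rw [this, List.take_append, ← List.map_take, List.take_take, ho']
    obtain ⟨r', hr', he'⟩ := hnext
    set b := colOut ((u.take (cut o)).map (· * c)) a
    refine ⟨colOut v b, (⟨colAct (r' ++ nextCol v b), r' ++ nextCol v b, ?_, rfl⟩, o', c * a),
      fun w => ?_⟩
    · intro x hx
      rcases List.mem_append.1 hx with hx | hx
      · exact hr' x hx
      · exact hI₀.nextCol_subset v hv b x hx
    · simp only [colAct_cons_right, he', colAct_append]
      rfl

/-- One letter makes any column descending, so the function is fixed by finite data for each first
letter. -/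
theorem finite_colAct_of_subideal {n : ℕ} (hM : ∀ x : M, x ^ n = x ^ (n + 1)) {I I₀ : Set M}
    (hI : IsIdealSet I) (hI₀ : IsIdealSet I₀)
    (hsq : ∀ x ∈ I, x * x ∉ I₀ → ∃ s t, x = s * (x * x) * t)
    (hfin : {f : List M → List M | ∃ u : List M, (∀ x ∈ u, x ∈ I₀) ∧ f = colAct u}.Finite) :
    {f : List M → List M | ∃ u : List M, (∀ x ∈ u, x ∈ I) ∧ f = colAct u}.Finite := by
  have hX := finite_colAct_isDescending hM hI hI₀ hsq hfin
  set X := {f : List M → List M |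
      ∃ u : List M, (∀ x ∈ u, x ∈ I) ∧ IsDescending u ∧ f = colAct u}
  have : Finite X := hX
  let F : (M → M × X) → List M → List M := fun d w =>
    match w with
    | [] => []
    | a :: w => (d a).1 :: (d a).2.1 w
  refine (Set.finite_range F).subset ?_
  rintro f ⟨u, hu, rfl⟩
  refine ⟨fun a => (colOut u a, ⟨colAct (nextCol u a), nextCol u a, hI.nextCol_subset u hu a,
    isDescending_nextCol u a, rfl⟩), ?_⟩
  funext w
  cases w with
  | nil => exact (colAct_nil_right u).symm
  | cons a w => exact (colAct_cons_right u a w).symm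

theorem exists_maximal_subideal {I : Set M} (hI : IsIdealSet I) (hne : I.Nonempty) :
    ∃ I₀ : Set M, IsIdealSet I₀ ∧ I₀ ⊂ I ∧
      ∀ x ∈ I, x * x ∉ I₀ → ∃ s t, x = s * (x * x) * t := by
  obtain ⟨I₀, hmax⟩ := (Set.toFinite {K : Set M | IsIdealSet K ∧ K ⊂ I}).exists_maximal
    -- The empty set counts as an ideal, so a minimal `I` is covered too.
    ⟨∅, fun _ h => absurd h (Set.notMem_empty _), Set.empty_ssubset.2 hne⟩
  obtain ⟨⟨hI₀, hlt⟩, hmax⟩ := hmax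
  refine ⟨I₀, hI₀, hlt, fun x hx hxx => ?_⟩
  by_contra hno
  push Not at hno
  have hx₀ : x ∉ I₀ := fun h => hxx (hI₀.mul_left h x)
  let K : Set M := I₀ ∪ {y | ∃ s t, y = s * (x * x) * t}
  have hK : IsIdealSet K := by
    rintro y (hy | ⟨s, t, rfl⟩) a b
    · exact Or.inl (hI₀ y hy a b)
    · exact Or.inr ⟨a * s, t * b, by simp only [mul_assoc]⟩
  have hxK : x ∉ K := by
    rintro (h | ⟨s, t, h⟩)
    · exact hx₀ h
    · exact hno s t h
  have hKI : K ⊂ I := by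
    refine ⟨?_, fun h => hxK (h hx)⟩
    rintro y (hy | ⟨s, t, rfl⟩)
    · exact hlt.1 hy
    · exact hI _ (hI.mul_left hx x) s t
  exact hxx (hmax ⟨hK, hKI⟩ Set.subset_union_left (Or.inr ⟨1, 1, by simp⟩))

theorem finite_colAct_of_isIdealSet {n : ℕ} (hM : ∀ x : M, x ^ n = x ^ (n + 1)) (I : Set M)
    (hI : IsIdealSet I) :
    {f : List M → List M | ∃ u : List M, (∀ x ∈ u, x ∈ I) ∧ f = colAct u}.Finite := by
  induction I using (wellFounded_lt (α := Set M)).induction with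
  | _ I ih =>
    rcases I.eq_empty_or_nonempty with rfl | hne
    · refine (Set.finite_singleton (colAct [])).subset ?_
      rintro f ⟨u, hu, rfl⟩
      have : u = [] := List.eq_nil_iff_forall_not_mem.2 hu
      rw [this]
      rfl
    · obtain ⟨I₀, hI₀, hlt, hsq⟩ := exists_maximal_subideal hI hne
      exact finite_colAct_of_subideal hM hI hI₀ hsq (ih I₀ hlt hI₀)

theorem finite_range_colAct {n : ℕ} (hM : ∀ x : M, x ^ n = x ^ (n + 1)) :
    (Set.range (colAct (M := M))).Finite := by
  refine (finite_colAct_of_isIdealSet hM Set.univ fun _ _ _ _ => trivial).subset ?_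
  rintro _ ⟨u, rfl⟩
  exact ⟨u, fun _ _ => trivial, rfl⟩

end Finiteness

/-! ### Stabilisation of iterates on each word. -/

section Periodicity

variable {M : Type*} [Monoid M]

/-- The column of letters produced, from a letter `a`, by the successive letters `c 0, c 1, …`. -/
def iterOut (c : ℕ → M) (a : M) : ℕ → M
  | 0 => a
  | i + 1 => c i * iterOut c a i

theorem colAct_map_range_cons (c : ℕ → M) (a : M) (w : List M) (i : ℕ) :
    colAct ((List.range i).map c) (a :: w) =
      iterOut c a i :: colAct ((List.range i).map fun j => iterOut c a (j + 1)) w := by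
  induction i with
  | zero => rfl
  | succ i ih => simp [List.range_succ, colAct_append, ih, colAct, partialProds, iterOut]

theorem iterOut_add (c : ℕ → M) (a : M) (i j : ℕ) :
    iterOut c a (i + j) = iterOut (fun k => c (i + k)) (iterOut c a i) j := by
  induction j with
  | zero => rfl
  | succ j ih => rw [← add_assoc, iterOut, ih, iterOut]

theorem iterOut_eq_mul (c : ℕ → M) (a : M) (i : ℕ) : iterOut c a i = iterOut c 1 i * a := by
  induction i with
  | zero => simp [iterOut]
  | succ i ih => simp only [iterOut, ih, mul_assoc]

/-- If `c` is eventually `m`-periodic, so is the column that it produces. -/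
theorem exists_forall_iterOut_add {n : ℕ} (hM : ∀ x : M, x ^ n = x ^ (n + 1)) {c : ℕ → M}
    {m N : ℕ} (hc : ∀ i ≥ N, c (i + m) = c i) (a : M) :
    ∀ i ≥ N + m * n, iterOut c a (i + m) = iterOut c a i := by
  have hc' : ∀ i ≥ N, ∀ k, c (i + m * k) = c i := by
    intro i hi k
    induction k with
    | zero => simp
    | succ k ih => rw [mul_add, mul_one, ← add_assoc, hc _ (by omega), ih]
  -- From a given i ≥ N on, each period multiplies on the left by the same element, whose powers are
  -- constant from exponent `n` on.
  have hpow : ∀ i ≥ N, ∀ k,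
      iterOut c a (i + m * k) = iterOut (fun j => c (i + j)) 1 m ^ k * iterOut c a i := by
    intro i hi k
    induction k with
    | zero => simp
    | succ k ih =>
      have : (fun j => c (i + m * k + j)) = fun j => c (i + j) := by
        funext j
        rw [show i + m * k + j = i + j + m * k by omega, hc' _ (by omega)]
      rw [mul_add, mul_one, ← add_assoc, iterOut_add, this, iterOut_eq_mul, ih, pow_succ',
        mul_assoc]
  intro i hi
  obtain ⟨j, rfl⟩ : ∃ j, i = j + m * n := ⟨i - m * n, by omega⟩
  rw [add_assoc, ← mul_add_one, hpow j (by omega), hpow j (by omega), ← hM]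

theorem exists_forall_colAct_add {n : ℕ} (hM : ∀ x : M, x ^ n = x ^ (n + 1)) {c : ℕ → M}
    {m N : ℕ} (hc : ∀ i ≥ N, c (i + m) = c i) (w : List M) :
    ∃ K, ∀ i ≥ K,
      colAct ((List.range (i + m)).map c) w = colAct ((List.range i).map c) w := by
  induction w generalizing c N with
  | nil => exact ⟨0, fun i _ => by rw [colAct_nil_right, colAct_nil_right]⟩
  | cons a w ih =>
    have h := exists_forall_iterOut_add hM hc a
    obtain ⟨K, hK⟩ := ih (c := fun j => iterOut c a (j + 1)) (N := N + m * n)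
      (fun i hi => by
        rw [show i + m + 1 = i + 1 + m by omega]
        exact h _ (by omega))
    refine ⟨max K (N + m * n), fun i hi => ?_⟩
    rw [colAct_map_range_cons, colAct_map_range_cons, h i (le_of_max_le_right hi),
      hK i (le_of_max_le_left hi)]

theorem exists_iterate_colAct_eq {n : ℕ} (hM : ∀ x : M, x ^ n = x ^ (n + 1)) (u w : List M) :
    ∃ K, ∀ k ≥ K, (colAct u)^[k + 1] w = (colAct u)^[k] w := by
  rcases Nat.eq_zero_or_pos u.length with h0 | hpos
  · refine ⟨0, fun k _ => ?_⟩
    rw [List.length_eq_zero_iff.1 h0, Function.iterate_succ_apply']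
    rfl
  let c : ℕ → M := fun i => u.getD (i % u.length) 1
  have hu : ∀ k, (List.range u.length).map (fun i => c (u.length * k + i)) = u := by
    intro k
    refine List.ext_getElem (by simp) fun i h1 h2 => ?_
    simp [c, Nat.mod_eq_of_lt h2, h2]
  have hit : ∀ k, colAct ((List.range (u.length * k)).map c) w = (colAct u)^[k] w := by
    intro k
    induction k with
    | zero => rfl
    | succ k ih =>
      rw [mul_add_one, List.range_add, List.map_append, List.map_map, colAct_append, ih,
        Function.iterate_succ_apply']
      congr 1
      exact hu k
  obtain ⟨K, hK⟩ := exists_forall_colAct_add hM (c := c) (m := u.length) (N := 0)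
    (fun i _ => by simp [c]) w
  refine ⟨K, fun k hk => ?_⟩
  rw [← hit, ← hit, mul_add_one, hK]
  exact hk.trans (Nat.le_mul_of_pos_left k hpos)

end Periodicity

/-! ### Powers and cyclic subgroups in a semigroup. -/

section Powers

variable {T : Type*} [Semigroup T]

theorem exists_coe_eq_coe_pow (x : T) {n : ℕ} (hn : 0 < n) :
    ∃ y : T, (y : WithOne T) = (x : WithOne T) ^ n := by
  induction n, hn using Nat.le_induction with
  | base => exact ⟨x, (pow_one _).symm⟩
  | succ n _ ih =>
    obtain ⟨y, hy⟩ := ih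
    exact ⟨y * x, by rw [pow_succ, ← hy, WithOne.coe_mul]⟩

/-- Exponents must be positive: the adjoined identity may have the same image in `N` as an element
of `T`. -/
theorem coe_pow_eq_coe_pow_iff {N : Type*} [Monoid N] {T : Subsemigroup N} (x : T) {n m : ℕ}
    (hn : 0 < n) (hm : 0 < m) :
    (x : WithOne T) ^ n = (x : WithOne T) ^ m ↔ (x : N) ^ n = (x : N) ^ m := by
  let φ : WithOne T →* N := WithOne.lift (MulMemClass.subtype T)
  have hφ : ∀ y : T, φ (y : WithOne T) = (y : N) := fun y => WithOne.lift_coe _ _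
  have hp : ∀ k, φ ((x : WithOne T) ^ k) = (x : N) ^ k := fun k => by rw [map_pow, hφ]
  refine ⟨fun h => by rw [← hp, ← hp, h], fun h => ?_⟩
  obtain ⟨y, hy⟩ := exists_coe_eq_coe_pow x hn
  obtain ⟨z, hz⟩ := exists_coe_eq_coe_pow x hm
  rw [← hp, ← hp, ← hy, ← hz, hφ, hφ] at h
  rw [← hy, ← hz, Subtype.ext h]

theorem IsPointwiseAperiodic.isAperiodic [Finite T] (h : IsPointwiseAperiodic T) :
    IsAperiodic T := by
  choose n _ hn using h
  obtain ⟨B, hB⟩ := (Set.finite_range n).bddAbove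
  refine ⟨B + 1, B.succ_pos, fun x => ?_⟩
  obtain ⟨k, hk⟩ := Nat.exists_eq_add_of_le
    ((hB (Set.mem_range_self x)).trans (Nat.le_add_right B 1))
  rw [hk, add_right_comm, pow_add, hn x, ← pow_add]

theorem IsAperiodic.exists_withOne (h : IsAperiodic T) :
    ∃ n : ℕ, ∀ x : WithOne T, x ^ n = x ^ (n + 1) := by
  obtain ⟨n, _, hn⟩ := h
  refine ⟨n, fun x => ?_⟩
  cases x with
  | one => simp
  | coe x => exact hn x

theorem NoNontrivialSubgroups.isPointwiseAperiodic [Finite T] (h : NoNontrivialSubgroups T) :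
    IsPointwiseAperiodic T := by
  intro x
  have : Finite (WithOne T) := inferInstanceAs (Finite (Option T))
  obtain ⟨a, b, hab, he⟩ : ∃ a b : ℕ, a < b ∧ (x : WithOne T) ^ a = (x : WithOne T) ^ b := by
    obtain ⟨a, b, hne, he⟩ :=
      Finite.exists_ne_map_eq_of_infinite fun k : ℕ => (x : WithOne T) ^ k
    rcases lt_or_gt_of_ne hne with hlt | hlt
    · exact ⟨a, b, hlt, he⟩
    · exact ⟨b, a, hlt, he.symm⟩
  obtain ⟨p, rfl⟩ := Nat.exists_eq_add_of_lt hab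
  rw [add_assoc] at he
  have hper : ∀ k ≥ a, ∀ q, (x : WithOne T) ^ (k + (p + 1) * q) = (x : WithOne T) ^ k := by
    intro k hk q
    obtain ⟨j, rfl⟩ := Nat.exists_eq_add_of_le hk
    induction q with
    | zero => simp
    | succ q ih =>
      rw [← ih, show a + j + (p + 1) * (q + 1) = a + (p + 1) + (j + (p + 1) * q) by ring,
        pow_add, ← he, ← pow_add, add_assoc]
  let G : Subsemigroup T :=
    { carrier := {y | ∃ k ≥ a + 1, (y : WithOne T) = (x : WithOne T) ^ k}
      mul_mem' := by
        rintro y z ⟨k, hk, hy⟩ ⟨l, hl, hz⟩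
        exact ⟨k + l, by omega, by rw [WithOne.coe_mul, hy, hz, pow_add]⟩ }
  have hmem : ∀ k ≥ a + 1, ∃ y ∈ G, (y : WithOne T) = (x : WithOne T) ^ k := by
    intro k hk
    obtain ⟨y, hy⟩ := exists_coe_eq_coe_pow x (n := k) (by omega)
    exact ⟨y, ⟨k, hk, hy⟩, hy⟩
  have hG : IsSubgroup G := by
    obtain ⟨e, heG, he⟩ := hmem ((p + 1) * (a + 1)) (Nat.le_mul_of_pos_left _ p.succ_pos)
    refine ⟨e, heG, ?_, ?_⟩
    · rintro g ⟨k, hk, hg⟩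
      constructor
      · rw [← WithOne.coe_inj, WithOne.coe_mul, he, hg, ← pow_add, add_comm, hper k (by omega)]
      · rw [← WithOne.coe_inj, WithOne.coe_mul, he, hg, ← pow_add, hper k (by omega)]
    · rintro g ⟨k, hk, hg⟩
      have hl : a + 1 ≤ (p + 1) * (a + 1) := Nat.le_mul_of_pos_left _ p.succ_pos
      -- Since k + k p is a multiple of the period p + 1, this power inverts x^k; the second summand
      -- makes the exponent large enough for `G`.
      obtain ⟨y, hyG, hy⟩ := hmem (k * p + (p + 1) * (a + 1)) (by omega)
      refine ⟨y, hyG, ?_, ?_⟩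
      · rw [← WithOne.coe_inj, WithOne.coe_mul, he, hg, hy, ← pow_add,
          show k + (k * p + (p + 1) * (a + 1)) = (p + 1) * (a + 1) + (p + 1) * k by ring,
          hper _ (by omega)]
      · rw [← WithOne.coe_inj, WithOne.coe_mul, he, hg, hy, ← pow_add,
          show k * p + (p + 1) * (a + 1) + k = (p + 1) * (a + 1) + (p + 1) * k by ring,
          hper _ (by omega)]
  obtain ⟨y, hyG, hy⟩ := hmem (a + 1) le_rfl
  obtain ⟨z, hzG, hz⟩ := hmem (a + 1 + 1) (Nat.le_succ _)
  exact ⟨a + 1, a.succ_pos, by rw [← hy, ← hz, h G hG hyG hzG]⟩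

end Powers

/-! ### `Cayley S` through columns, and its effect on subgroups. -/

section Cayley

variable {S : Type*} [Semigroup S]

theorem map_val_gen (s : S) (w : List (S1 S)) :
    (gen s w).map Subtype.val = partialProds (s : WithOne S) (w.map Subtype.val) := by
  simp only [gen]
  induction w generalizing s with
  | nil => rfl
  | cons a w ih =>
    simp only [phi, List.map_cons, partialProds, ih, ← coe_mulWithOne]
    rfl

/-- The members of `Cayley S` are restrictions of functions given by columns over `WithOne S`. -/
theorem exists_map_val_eq_colAct {f : Function.End (List (S1 S))} (hf : f ∈ Cayley S) :
    ∃ u : List (WithOne S), ∀ w, (f w).map Subtype.val = colAct u (w.map Subtype.val) := by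
  induction hf using Subsemigroup.closure_induction with
  | mem f hf =>
    obtain ⟨s, rfl⟩ := hf
    exact ⟨[(s : WithOne S)], fun w => map_val_gen s w⟩
  | mul f g _ _ hf hg =>
    obtain ⟨u, hu⟩ := hf
    obtain ⟨v, hv⟩ := hg
    refine ⟨v ++ u, fun w => ?_⟩
    rw [colAct_append, ← hv, ← hu]
    rfl

theorem map_val_injective :
    Function.Injective (List.map (Subtype.val : S1 S → WithOne S)) :=
  List.map_injective_iff.2 Subtype.val_injective

theorem IsAperiodic.finite_cayley [Finite S] (h : IsAperiodic S) : Finite (Cayley S) := by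
  obtain ⟨n, hn⟩ := h.exists_withOne
  have : Finite (WithOne S) := inferInstanceAs (Finite (Option S))
  have : Finite (Set.range (colAct (M := WithOne S))) := finite_range_colAct hn
  choose u hu using fun f : Cayley S => exists_map_val_eq_colAct f.2
  refine Finite.of_injective
    (fun f : Cayley S => (⟨colAct (u f), u f, rfl⟩ : Set.range (colAct (M := WithOne S)))) ?_
  intro f g hfg
  have h : colAct (u f) = colAct (u g) := congrArg Subtype.val hfg
  exact Subtype.ext (funext fun w => map_val_injective (by rw [hu, hu, h]))

theorem exists_pow_eq_pow_add [Finite (Cayley S)] {f : Function.End (List (S1 S))}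
    (hf : f ∈ Cayley S) : ∃ N p : ℕ, 0 < p ∧ f ^ N = f ^ (N + p) := by
  have hmem : ∀ k : ℕ, f ^ (k + 1) ∈ Cayley S := by
    intro k
    induction k with
    | zero => rwa [zero_add, pow_one]
    | succ k ih => rw [pow_succ]; exact mul_mem ih hf
  obtain ⟨a, b, hne, he⟩ :=
    Finite.exists_ne_map_eq_of_infinite fun k : ℕ => (⟨f ^ (k + 1), hmem k⟩ : Cayley S)
  have he : f ^ (a + 1) = f ^ (b + 1) := congrArg Subtype.val he
  rcases lt_or_gt_of_ne hne with hlt | hlt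
  · exact ⟨a + 1, b - a, by omega, by rw [he]; congr 1; omega⟩
  · exact ⟨b + 1, a - b, by omega, by rw [← he]; congr 1; omega⟩

theorem IsAperiodic.isPointwiseAperiodic_cayley [Finite S] (h : IsAperiodic S) :
    IsPointwiseAperiodic (Cayley S) := by
  have : Finite (Cayley S) := h.finite_cayley
  obtain ⟨n, hn⟩ := h.exists_withOne
  rintro ⟨f, hf⟩
  obtain ⟨N, p, hp, hper⟩ := exists_pow_eq_pow_add hf
  have hper' : ∀ k, f ^ (N + p * k) = f ^ N := by
    intro k
    induction k with
    | zero => simp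
    | succ k ih => rw [mul_add_one, ← add_assoc, pow_add, ih, ← pow_add, ← hper]
  obtain ⟨u, hu⟩ := exists_map_val_eq_colAct hf
  have hpow : ∀ k w, ((f ^ k) w).map Subtype.val = (colAct u)^[k] (w.map Subtype.val) := by
    intro k w
    induction k with
    | zero => rfl
    | succ k ih =>
      rw [pow_succ', Function.iterate_succ_apply', ← ih, ← hu]
      rfl
  -- The threshold `K` depends on the word, but f^(N + pK) = f^N passes every threshold.
  have hst : f ^ N = f ^ (N + 1) := by
    funext w
    obtain ⟨K, hK⟩ := exists_iterate_colAct_eq hn u (w.map Subtype.val)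
    have hle : K ≤ N + p * K := (Nat.le_mul_of_pos_left K hp).trans (Nat.le_add_left _ _)
    refine map_val_injective ?_
    have := hK _ hle
    rw [← hpow, ← hpow, pow_succ, hper', ← pow_succ] at this
    exact this.symm
  refine ⟨N + 1, N.succ_pos, (coe_pow_eq_coe_pow_iff _ N.succ_pos (N + 1).succ_pos).2 ?_⟩
  change f ^ (N + 1) = f ^ (N + 1 + 1)
  rw [pow_succ, pow_succ f (N + 1), ← hst]

theorem gen_map_range (a : ℕ → S) (c : ℕ → S) (hc : ∀ i, c i * a i = c (i + 1)) (k : ℕ) :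
    gen (c 0) ((List.range k).map fun i => incl (a i)) =
      (List.range k).map fun i => incl (c (i + 1)) := by
  simp only [gen]
  induction k generalizing a c with
  | zero => rfl
  | succ k ih =>
    have := ih (fun i => a (i + 1)) (fun i => c (i + 1)) fun i => hc (i + 1)
    simp only [List.range_succ_eq_map, List.map_cons, List.map_map]
    change incl (c 0 * a 0) :: (phi (c 0 * a 0) _).map incl = _
    rw [hc 0]
    exact congrArg _ this

open Polynomial in
theorem gen_zpow_eq_of_pow_eq {θ : ℤ → S} (hθ : ∀ a b, θ (a + b) = θ a * θ b) {N p : ℕ}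
    (h : gen (θ 0) ^ N = gen (θ 0) ^ (N + p)) (hp : 0 < p) : θ 1 = θ 0 := by
  let W : ℤ[X] → List (S1 S) := fun q => (List.range (p + 1)).map fun i => incl (θ (q.coeff i))
  -- Partial sums of the coefficients of (1 - X) q are the coefficients of q.
  have hstep : ∀ q : ℤ[X], gen (θ 0) (W ((1 - X) * q)) = W q := by
    intro q
    refine gen_map_range (fun i => θ (((1 - X) * q).coeff i))
      (fun i => Nat.casesOn i (θ 0) fun j => θ (q.coeff j)) (fun i => ?_) (p + 1)
    cases i with
    | zero => simp [← hθ, sub_mul]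
    | succ i => simp [← hθ, sub_mul]
  have hiter : ∀ (m : ℕ) (q : ℤ[X]), (gen (θ 0) ^ m) (W ((1 - X) ^ m * q)) = W q := by
    intro m q
    induction m with
    | zero => rw [pow_zero, pow_zero, one_mul]; rfl
    | succ m ih =>
      rw [pow_succ, pow_succ', mul_assoc]
      change (gen (θ 0) ^ m) (gen (θ 0) (W _)) = _
      rw [hstep, ih]
  have hW : W ((1 - X) ^ p) = W 1 := by
    rw [← hiter (N + p) 1, ← h, mul_one, pow_add, hiter]
  -- At degree `p` the two series have coefficients (-1)^p and 0.
  have hlast : θ ((((1 - X) ^ p : ℤ[X])).coeff p) = θ ((1 : ℤ[X]).coeff p) := by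
    have := List.map_inj_left.1 hW p (by simp)
    exact WithOne.coe_inj.1 (congrArg Subtype.val this)
  have hcoeff : ((1 - X : ℤ[X]) ^ p).coeff p = (-1) ^ p := by
    have hdeg : (1 - X : ℤ[X]).natDegree ≤ 1 := by
      compute_degree
    simpa [coeff_one] using coeff_pow_of_natDegree_le (m := p) hdeg
  rw [hcoeff, coeff_one, if_neg (by omega)] at hlast
  rcases neg_one_pow_eq_or ℤ p with h1 | h1
  · rwa [h1] at hlast
  · rw [h1] at hlast
    calc θ 1 = θ (1 + 0) := by simp
      _ = θ 1 * θ (-1) := by rw [hθ, hlast]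
      _ = θ 0 := by rw [← hθ]; simp

theorem IsSubgroup.exists_zpow {G : Subsemigroup S} (hG : IsSubgroup G) :
    ∃ e : S, ∀ g ∈ G, ∃ θ : ℤ → S, θ 0 = e ∧ θ 1 = g ∧ ∀ a b, θ (a + b) = θ a * θ b := by
  obtain ⟨e, he, hid, hinv⟩ := hG
  choose inv hmem hinv using hinv
  let _ : One G := ⟨⟨e, he⟩⟩
  let _ : Inv G := ⟨fun g => ⟨inv g g.2, hmem g g.2⟩⟩
  let _ : Group G := Group.ofLeftAxioms mul_assoc (fun g => Subtype.ext (hid g g.2).1)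
    fun g => Subtype.ext (hinv g g.2).2
  refine ⟨e, fun g hg => ⟨fun k => (((⟨g, hg⟩ : G) ^ k : G) : S), ?_, ?_, ?_⟩⟩
  · change (((⟨g, hg⟩ : G) ^ (0 : ℤ) : G) : S) = ((1 : G) : S)
    rw [zpow_zero]
  · change (((⟨g, hg⟩ : G) ^ (1 : ℤ) : G) : S) = g
    rw [zpow_one]
  · intro a b
    change (((⟨g, hg⟩ : G) ^ (a + b) : G) : S) = _
    rw [zpow_add]
    rfl

theorem noNontrivialSubgroups_of_gen_pow_eq
    (h : ∀ s : S, ∃ N p : ℕ, 0 < p ∧ gen s ^ N = gen s ^ (N + p)) :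
    NoNontrivialSubgroups S := by
  intro G hG
  obtain ⟨e, he⟩ := hG.exists_zpow
  have key : ∀ g ∈ G, g = e := by
    intro g hg
    obtain ⟨θ, rfl, rfl, hθ⟩ := he g hg
    obtain ⟨N, p, hp, hN⟩ := h (θ 0)
    exact gen_zpow_eq_of_pow_eq hθ hN hp
  intro g hg k hk
  rw [key g hg, key k hk]

theorem gen_mem_cayley (s : S) : gen s ∈ Cayley S :=
  Subsemigroup.subset_closure ⟨s, rfl⟩

end Cayley

end CayleySemigroup

theorem mainTheorem3 {S : Type*} [Semigroup S] [Finite S] :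
    List.TFAE
      [CayleySemigroup.NoNontrivialSubgroups S,
        CayleySemigroup.IsAperiodic S,
        Finite (CayleySemigroup.Cayley S),
        CayleySemigroup.IsAperiodic (CayleySemigroup.Cayley S),
        CayleySemigroup.IsPointwiseAperiodic (CayleySemigroup.Cayley S)] := by
  tfae_have 1 → 2 := fun h => h.isPointwiseAperiodic.isAperiodic
  tfae_have 2 → 3 := fun h => h.finite_cayley
  tfae_have 2 → 4 := fun h =>
    have := h.finite_cayley
    h.isPointwiseAperiodic_cayley.isAperiodic
  tfae_have 4 → 5 := fun ⟨n, hn, h⟩ x => ⟨n, hn, h x⟩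
  tfae_have 3 → 1 := fun _ =>
    CayleySemigroup.noNontrivialSubgroups_of_gen_pow_eq fun s =>
      CayleySemigroup.exists_pow_eq_pow_add (CayleySemigroup.gen_mem_cayley s)
  tfae_have 5 → 1 := fun h =>
    CayleySemigroup.noNontrivialSubgroups_of_gen_pow_eq fun s => by
      obtain ⟨n, hn, hs⟩ := h ⟨CayleySemigroup.gen s, CayleySemigroup.gen_mem_cayley s⟩
      exact ⟨n, 1, one_pos,
        (CayleySemigroup.coe_pow_eq_coe_pow_iff _ hn n.succ_pos).1 hs⟩
  tfae_finish
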